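/- All graphs are finite, undirected and simple. Let $\Gamma$ be a connected graph with path distance $d$ and diameter $D$; write $\Gamma_j(x)$ for the set of vertices at distance $j$ from $x$, and $\Gamma(x)=\Gamma_1(x)$. The local graph $\Delta_x$ is the subgraph of $\Gamma$ induced on $\Gamma(x)$. The graph $\Gamma$ is distance-regular if there are integers $b_i,c_i$ such that, whenever $d(x,y)=i$, the vertex $y$ has exactly $c_i$ neighbours in $\Gamma_{i-1}(x)$ (where $\Gamma_{-1}(x)=\emptyset$) and exactly $b_i$ neighbours in $\Gamma_{i+1}(x)$. For a real number $b$ put $[j]=1+b+\cdots+b^{j-1}$. A distance-regular graph has classical parameters $(D,b,\alpha,\beta)$, where $b,\alpha,\beta$ are real numbers, if it has diameter $D$, $b_i=([D]-[i])(\beta-\alpha[i])$ for $0\le i\le D-1$, and $c_i=[i](1+\alpha[i-1])$ for $1\le i\le D$. A distance-regular graph with valency $k$ and smallest adjacency eigenvalue $\theta_{\min}$ is geometric if there is a set $\mathcal C$ of cliques, each with exactly $1+\frac{k}{-\theta_{\min}}$ vertices, such that every edge lies in a unique member of $\mathcal C$. The $m\times n$-grid is the Cartesian product $K_m\Box K_n$.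 For a positive integer $s$, the $s$-clique extension of a graph is obtained by replacing each vertex by a complete graph on $s$ vertices, two vertices in different complete graphs being adjacent if and only if the original vertices are adjacent. Theorem. Let $\Gamma$ be a geometric distance-regular graph with classical parameters $(D,b,\alpha,\beta)$ such that $b\ge 2$, $1\le\alpha\le b-1$ and $D\ge 3$, and let $r=[D]$. Assume that for every vertex $x$ of $\Gamma$ the local graph $\Delta_x$ is isomorphic to the $\alpha$-clique extension of a $\frac{\beta}{\alpha}\times r$-grid (so, in particular, $\alpha$, $\frac{\beta}{\alpha}$ and $r$ are positive integers), and assume that $\beta>\alpha r$. Then for every $i\in\{2,3,\ldots,D\}$ and all vertices $x,y$ with $d(x,y)=i$, the number $[i]$ is an integer and the subgraph of $\Gamma$ induced on $C_i(x,y)=\Gamma_{i-1}(x)\cap\Gamma(y)$ is isomorphic to an induced subgraph of the $[i]\times[i]$-grid. -/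

import Mathlib

noncomputable section

namespace ClassicalDRG

universe u v

/-- The number `[j] = 1 + b + ⋯ + b ^ (j - 1)`, that is, `(b ^ j - 1) / (b - 1)` if `b ≠ 1`
and `j` if `b = 1`. -/
def bracket (b : ℝ) (j : ℕ) : ℝ := ∑ k ∈ Finset.range j, b ^ k

/-- `C_i(x, y) = Γ_{i-1}(x) ∩ Γ(y)`, with `Γ_{-1}(x) = ∅`. -/
def CSet {V : Type u} (G : SimpleGraph V) (i : ℕ) (x y : V) : Set V :=
  {z | G.dist x z + 1 = i ∧ G.Adj y z}

/-- `B_i(x, y) = Γ_{i+1}(x) ∩ Γ(y)`. -/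
def BSet {V : Type u} (G : SimpleGraph V) (i : ℕ) (x y : V) : Set V :=
  {z | G.dist x z = i + 1 ∧ G.Adj y z}

/-- The finite connected graph `G` is distance-regular with intersection numbers
`b_i = bi i` and `c_i = ci i`. -/
structure HasIntersectionNumbers {V : Type u} [Finite V] (G : SimpleGraph V) (bi ci : ℕ → ℕ) :
    Prop where
  connected : G.Connected
  card_BSet : ∀ (i : ℕ) (x y : V), G.dist x y = i → (BSet G i x y).ncard = bi i
  card_CSet : ∀ (i : ℕ) (x y : V), G.dist x y = i → (CSet G i x y).ncard = ci i

/-- A finite graph is distance-regular if it is connected and has intersection numbers. -/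
def IsDistanceRegular {V : Type u} [Finite V] (G : SimpleGraph V) : Prop :=
  ∃ bi ci : ℕ → ℕ, HasIntersectionNumbers G bi ci

/-- `G` is a distance-regular graph with classical parameters `(D, b, α, β)`. -/
def HasClassicalParameters {V : Type u} [Finite V] (G : SimpleGraph V) (D : ℕ) (b α β : ℝ) :
    Prop :=
  G.diam = D ∧ ∃ bi ci : ℕ → ℕ, HasIntersectionNumbers G bi ci ∧
    (∀ i : ℕ, i < D → (bi i : ℝ) = (bracket b D - bracket b i) * (β - α * bracket b i)) ∧
    (∀ i : ℕ, 1 ≤ i → i ≤ D → (ci i : ℝ) = bracket b i * (1 + α * bracket b (i - 1)))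

/-- `θ` is the smallest eigenvalue of the adjacency matrix of `G`. -/
def IsSmallestEigenvalue {V : Type u} [Fintype V] [DecidableEq V] (G : SimpleGraph V)
    [DecidableRel G.Adj] (θ : ℝ) : Prop :=
  IsLeast {t : ℝ | Module.End.HasEigenvalue (Matrix.toLin' (G.adjMatrix ℝ)) t} θ

/-- A Delsarte clique of a regular graph of valency `k` with smallest eigenvalue `θ`: a clique
with exactly `1 + k / (-θ)` vertices. -/
def IsDelsarteClique {V : Type u} [Fintype V] [DecidableEq V] (G : SimpleGraph V)
    [DecidableRel G.Adj] (C : Set V) : Prop :=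
  G.IsClique C ∧ ∃ (k : ℕ) (θ : ℝ), G.IsRegularOfDegree k ∧ IsSmallestEigenvalue G θ ∧
    (C.ncard : ℝ) = 1 + (k : ℝ) / (-θ)

/-- A distance-regular graph is geometric if there is a set `𝓒` of Delsarte cliques such that
each edge lies in a unique member of `𝓒`. -/
def IsGeometric {V : Type u} [Fintype V] [DecidableEq V] (G : SimpleGraph V)
    [DecidableRel G.Adj] : Prop :=
  IsDistanceRegular G ∧ ∃ 𝓒 : Set (Set V), (∀ C ∈ 𝓒, IsDelsarteClique G C) ∧
    ∀ u v : V, G.Adj u v → ∃! C : Set V, C ∈ 𝓒 ∧ u ∈ C ∧ v ∈ C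

/-- The `m × n`-grid, the Cartesian product of `K_m` and `K_n`. -/
def grid (m n : ℕ) : SimpleGraph (Fin m × Fin n) :=
  SimpleGraph.boxProd (⊤ : SimpleGraph (Fin m)) (⊤ : SimpleGraph (Fin n))

/-- The `s`-clique extension of `H`: each vertex is replaced by a complete graph on `s` vertices,
and vertices in different complete graphs are adjacent iff the original vertices are. -/
def cliqueExtension {W : Type v} (H : SimpleGraph W) (s : ℕ) : SimpleGraph (W × Fin s) where
  Adj p q := H.Adj p.1 q.1 ∨ (p.1 = q.1 ∧ p.2 ≠ q.2)
  symm := ⟨by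
    rintro p q (h | ⟨h, h'⟩)
    · exact Or.inl h.symm
    · exact Or.inr ⟨h.symm, h'.symm⟩⟩
  loopless := ⟨by
    rintro p (h | ⟨_, h⟩)
    · exact H.loopless.irrefl _ h
    · exact h rfl⟩

/-- `H` is (isomorphic to) the `s`-clique extension of the `m × n`-grid. The parameters are given
as real numbers; that `s` is a positive integer and that `m`, `n` are natural numbers is part of
the assertion. -/
def IsCliqueExtensionOfGrid {W : Type v} (H : SimpleGraph W) (s m n : ℝ) : Prop :=
  ∃ s' m' n' : ℕ, 0 < s' ∧ (s' : ℝ) = s ∧ (m' : ℝ) = m ∧ (n' : ℝ) = n ∧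
    Nonempty (H ≃g cliqueExtension (grid m' n') s')

/-- `H` is (isomorphic to) an induced subgraph of the `m × n`-grid. The parameters are given as
real numbers; that they are natural numbers is part of the assertion. -/
def IsInducedSubgraphOfGrid {W : Type v} (H : SimpleGraph W) (m n : ℝ) : Prop :=
  ∃ m' n' : ℕ, (m' : ℝ) = m ∧ (n' : ℝ) = n ∧ Nonempty (H ↪g grid m' n')

/-- The local graph of `G` at `x`: the subgraph induced on the neighbours of `x`. -/
def localGraph {V : Type u} (G : SimpleGraph V) (x : V) : SimpleGraph (G.neighborSet x) :=
  G.induce (G.neighborSet x)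

end ClassicalDRG

end

/-! Write `n = [D]`, `s = α`, `m = β/α`. Each local graph is an `s`-clique extension of an `m ×
n`-grid, with rows of `ms = β` vertices and columns of `ns < ms` vertices. Hence the cliques with
`ms + 1` vertices are exactly the sets `{y} ∪ row`. Call them lines: `n` pass through each vertex
and each edge lies on one, so `A + nI = N Nᵀ` for the incidence matrix `N`, and every eigenvector
for `-n` sums to zero on each line (`sum_line_eq_zero`).

For fixed `x`, the standard sequence of `-[D]`, evaluated at the distance from `x`, is such an
eigenvector. A line meets at most two consecutive distance classes in the cases needed, so its zero
sum fixes how many vertices lie in each: a row of the local graph at `y` that meets `C_i(x,y)` meets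
it in `1 + α[i-1]` vertices (`card_row_nearer`). Since `c_i = [i](1 + α[i-1])`, exactly `[i]` rows
are met.

The same count for columns goes by induction on `i`. If `C_i(x,z)` occupies `[i]` columns, counting
along a free row shows that every neighbour of `z` in a free row and a free column is farther from
`x` (`mem_farther_of_forall_ne`). This determines the columns one step further out
(`card_col_nearer`), and also shows that each cell holds at most one vertex of `C_i`
(`eq_of_row_eq_of_col_eq`). Row and column are then the required grid coordinates. -/

namespace ClassicalDRG

/-! ### Coordinates on the local graphs -/

/-- `row` and `col` are coordinates on all local graphs of `G`, exhibiting each of them as the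
`s`-clique extension of a grid with `m` columns and `n` rows. -/
structure LocalGrid {V : Type*} [Fintype V] [DecidableEq V] (G : SimpleGraph V)
    [DecidableRel G.Adj] (s m n : ℕ) (row col : V → V → ℕ) : Prop where
  row_lt : ∀ y w, G.Adj y w → row y w < n
  col_lt : ∀ y w, G.Adj y w → col y w < m
  adj_iff : ∀ y w w', G.Adj y w → G.Adj y w' →
    (G.Adj w w' ↔ w ≠ w' ∧ (row y w = row y w' ∨ col y w = col y w'))
  card_cell : ∀ y j a, j < n → a < m →
    ((G.neighborFinset y).filter (fun w => row y w = j ∧ col y w = a)).card = s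

theorem exists_coordinates {V : Type*} [Fintype V] [DecidableEq V] (G : SimpleGraph V)
    [DecidableRel G.Adj] (s m n : ℕ) (y : V)
    (e : localGraph G y ≃g cliqueExtension (grid m n) s) :
    ∃ row col : V → ℕ, (∀ w, G.Adj y w → row w < n) ∧ (∀ w, G.Adj y w → col w < m) ∧
      (∀ w w', G.Adj y w → G.Adj y w' →
        (G.Adj w w' ↔ w ≠ w' ∧ (row w = row w' ∨ col w = col w'))) ∧
      ∀ j a, j < n → a < m →
        ((G.neighborFinset y).filter (fun w => row w = j ∧ col w = a)).card = s := by
  classical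
  refine ⟨fun w => if h : G.Adj y w then ((e ⟨w, h⟩).1.2 : ℕ) else 0,
    fun w => if h : G.Adj y w then ((e ⟨w, h⟩).1.1 : ℕ) else 0, ?_, ?_, ?_, ?_⟩
  · intro w h
    simp [h]
  · intro w h
    simp [h]
  · intro w w' h h'
    have key : G.Adj w w' ↔ (cliqueExtension (grid m n) s).Adj (e ⟨w, h⟩) (e ⟨w', h'⟩) := by
      rw [e.map_adj_iff]
      rfl
    have hne : w = w' ↔ e ⟨w, h⟩ = e ⟨w', h'⟩ :=
      ⟨fun hh => by subst hh; rfl, fun hh => congrArg Subtype.val (e.injective hh)⟩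
    rw [key, Ne, hne]
    simp only [h, h', dite_true]
    generalize e ⟨w, h⟩ = p
    generalize e ⟨w', h'⟩ = q
    obtain ⟨⟨p1, p2⟩, p3⟩ := p
    obtain ⟨⟨q1, q2⟩, q3⟩ := q
    simp only [cliqueExtension, grid, SimpleGraph.boxProd_adj, SimpleGraph.top_adj, Prod.mk.injEq,
      Fin.val_inj]
    tauto
  · intro j a hj ha
    have hinj : Function.Injective
        (fun t : Fin s => ((e.symm ((⟨a, ha⟩, ⟨j, hj⟩), t)) : V)) := by
      intro t t' h
      have := e.symm.injective (Subtype.ext h)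
      simpa using this
    have := Finset.card_image_of_injective Finset.univ hinj
    rw [Finset.card_univ, Fintype.card_fin] at this
    refine Eq.trans ?_ this
    congr 1
    ext w
    simp only [Finset.mem_filter, SimpleGraph.mem_neighborFinset, Finset.mem_image,
      Finset.mem_univ, true_and]
    constructor
    · rintro ⟨h, h1, h2⟩
      simp only [h, dite_true] at h1 h2
      refine ⟨(e ⟨w, h⟩).2, ?_⟩
      have : ((⟨a, ha⟩, ⟨j, hj⟩), (e ⟨w, h⟩).2) = e ⟨w, h⟩ := by
        ext <;> simp [h1, h2]
      rw [this]
      simp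
    · rintro ⟨t, rfl⟩
      have h : G.Adj y (e.symm ((⟨a, ha⟩, ⟨j, hj⟩), t)) := (e.symm _).2
      have he : e ⟨(e.symm ((⟨a, ha⟩, ⟨j, hj⟩), t) : V), h⟩ = ((⟨a, ha⟩, ⟨j, hj⟩), t) :=
        e.apply_symm_apply _
      refine ⟨h, ?_, ?_⟩ <;> simp only [h, dite_true, he]

theorem exists_localGrid {V : Type*} [Fintype V] [DecidableEq V] (G : SimpleGraph V)
    [DecidableRel G.Adj] (s m n : ℕ)
    (e : ∀ y, Nonempty (localGraph G y ≃g cliqueExtension (grid m n) s)) :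
    ∃ row col : V → V → ℕ, LocalGrid G s m n row col := by
  choose row col h1 h2 h3 h4 using fun y => exists_coordinates G s m n y (e y).some
  exact ⟨row, col, h1, h2, h3, h4⟩

/-! ### Lines, symmetry of rows and columns, and eigenvectors for `-n` -/

namespace LocalGrid

variable {V : Type*} [Fintype V] [DecidableEq V] {G : SimpleGraph V} [DecidableRel G.Adj]
  {s m n : ℕ} {row col : V → V → ℕ}

theorem card_block (h : LocalGrid G s m n row col) (y : V) {J A : Finset ℕ}
    (hJ : ∀ j ∈ J, j < n) (hA : ∀ a ∈ A, a < m) :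
    ((G.neighborFinset y).filter (fun w => row y w ∈ J ∧ col y w ∈ A)).card
      = J.card * A.card * s := by
  rw [Finset.card_eq_sum_card_fiberwise (f := fun w => (row y w, col y w)) (t := J ×ˢ A)]
  · rw [Finset.sum_const_nat (m := s), Finset.card_product]
    rintro ⟨j, a⟩ hja
    rw [Finset.mem_product] at hja
    rw [← h.card_cell y j a (hJ _ hja.1) (hA _ hja.2), Finset.filter_filter]
    congr 1
    ext w
    simp only [Finset.mem_filter, Prod.mk.injEq]
    constructor
    · tauto
    · rintro ⟨h1, rfl, rfl⟩
      exact ⟨h1, hja, rfl, rfl⟩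
  · intro w hw
    rw [Finset.mem_coe, Finset.mem_filter] at hw
    simpa using hw.2

theorem card_row (h : LocalGrid G s m n row col) (y : V) {j : ℕ} (hj : j < n) :
    ((G.neighborFinset y).filter (fun w => row y w = j)).card = m * s := by
  have := h.card_block y (J := {j}) (A := Finset.range m) (by simpa using hj) (by simp)
  rw [Finset.card_singleton, Finset.card_range, one_mul] at this
  rw [← this]
  congr 1
  ext w
  simp only [Finset.mem_filter, SimpleGraph.mem_neighborFinset, Finset.mem_singleton,
    Finset.mem_range]
  constructor
  · rintro ⟨h1, h2⟩
    exact ⟨h1, h2, h.col_lt _ _ h1⟩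
  · tauto

theorem card_col (h : LocalGrid G s m n row col) (y : V) {a : ℕ} (ha : a < m) :
    ((G.neighborFinset y).filter (fun w => col y w = a)).card = n * s := by
  have := h.card_block y (J := Finset.range n) (A := {a}) (by simp) (by simpa using ha)
  rw [Finset.card_singleton, Finset.card_range, mul_one] at this
  rw [← this]
  congr 1
  ext w
  simp only [Finset.mem_filter, SimpleGraph.mem_neighborFinset, Finset.mem_singleton,
    Finset.mem_range]
  constructor
  · rintro ⟨h1, h2⟩
    exact ⟨h1, h.row_lt _ _ h1, h2⟩
  · tauto

theorem degree_eq (h : LocalGrid G s m n row col) (y : V) :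
    (G.neighborFinset y).card = n * m * s := by
  have := h.card_block y (J := Finset.range n) (A := Finset.range m) (by simp) (by simp)
  rw [Finset.card_range, Finset.card_range] at this
  rw [← this, Finset.filter_true_of_mem]
  intro w hw
  rw [SimpleGraph.mem_neighborFinset] at hw
  simp [h.row_lt _ _ hw, h.col_lt _ _ hw]

/-- A clique in a local graph that is larger than a column lies in a row. -/
theorem row_eq_of_clique (h : LocalGrid G s m n row col) {y : V} {K : Finset V}
    (hK : ∀ w ∈ K, G.Adj y w) (hc : G.IsClique (K : Set V)) (hcard : n * s < K.card)
    {w w' : V} (hw : w ∈ K) (hw' : w' ∈ K) : row y w = row y w' := by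
  by_contra hne
  have hww : w ≠ w' := fun e => hne (by rw [e])
  have hcol : col y w = col y w' :=
    (((h.adj_iff y w w' (hK _ hw) (hK _ hw')).1 (hc hw hw' hww)).2).resolve_left hne
  -- A vertex of `K` outside the common column of `w` and `w'` would have to share the rows of both,
  -- which differ.
  have : K ⊆ (G.neighborFinset y).filter (fun v => col y v = col y w) := by
    intro v hv
    simp only [Finset.mem_filter, SimpleGraph.mem_neighborFinset]
    refine ⟨hK _ hv, ?_⟩
    by_contra hvc
    have h1 : v ≠ w := fun e => hvc (by rw [e])
    have h2 : v ≠ w' := fun e => hvc (by rw [e, hcol])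
    have h3 := (((h.adj_iff y v w (hK _ hv) (hK _ hw)).1 (hc hv hw h1)).2).resolve_right hvc
    have h4 := (((h.adj_iff y v w' (hK _ hv) (hK _ hw')).1 (hc hv hw' h2)).2).resolve_right
      (by rwa [← hcol])
    exact hne (h3.symm.trans h4)
  have := Finset.card_le_card this
  rw [h.card_col y (h.col_lt _ _ (hK _ hw))] at this
  omega

variable (G row) in
/-- The line through `y` formed by `y` and row `j` of its local graph. -/
def line (y : V) (j : ℕ) : Finset V :=
  insert y ((G.neighborFinset y).filter (fun w => row y w = j))

variable (G row) in
theorem mem_line {y : V} {j : ℕ} {w : V} :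
    w ∈ line G row y j ↔ w = y ∨ (G.Adj y w ∧ row y w = j) := by
  simp [line]

variable (G m s) in
/-- The lines of `G`: the cliques with `m * s + 1` vertices. -/
def lines : Finset (Finset V) := by
  classical exact Finset.univ.filter (fun l => G.IsClique (l : Set V) ∧ l.card = m * s + 1)

theorem mem_lines {l : Finset V} :
    l ∈ lines G s m ↔ G.IsClique (l : Set V) ∧ l.card = m * s + 1 := by
  simp [lines]

theorem line_mem_lines (h : LocalGrid G s m n row col) (y : V) {j : ℕ} (hj : j < n) :
    line G row y j ∈ lines G s m := by
  rw [mem_lines]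
  constructor
  · intro w hw w' hw' hne
    rw [Finset.mem_coe, mem_line] at hw hw'
    rcases hw with rfl | ⟨h1, h2⟩
    · rcases hw' with rfl | ⟨h3, h4⟩
      · exact absurd rfl hne
      · exact h3
    · rcases hw' with rfl | ⟨h3, h4⟩
      · exact h1.symm
      · exact (h.adj_iff y w w' h1 h3).2 ⟨hne, Or.inl (h2.trans h4.symm)⟩
  · rw [line, Finset.card_insert_of_notMem (by simp), h.card_row y hj]

/-- Deleting `y` leaves a clique of `ms > ns` neighbours of `y`, too large for a column, so it lies
in a row; sizes then agree. In particular two adjacent vertices lie on only one line. -/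
theorem eq_line_of_mem (h : LocalGrid G s m n row col) (hs : 0 < s) (hmn : n < m)
    {l : Finset V} (hl : l ∈ lines G s m) {y w : V} (hy : y ∈ l) (hw : w ∈ l) (hne : w ≠ y) :
    l = line G row y (row y w) := by
  rw [mem_lines] at hl
  obtain ⟨hc, hcard⟩ := hl
  have hadj : ∀ v ∈ l.erase y, G.Adj y v := by
    intro v hv
    rw [Finset.mem_erase] at hv
    exact hc hy hv.2 hv.1.symm
  have hsub : l ⊆ line G row y (row y w) := by
    intro v hv
    rw [mem_line]
    by_cases hvy : v = y
    · exact Or.inl hvy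
    · refine Or.inr ⟨hadj v (by simp [hvy, hv]), ?_⟩
      refine h.row_eq_of_clique hadj ?_ ?_ (by simp [hvy, hv]) (by simp [hne, hw])
      · exact hc.subset (by simp)
      · rw [Finset.card_erase_of_mem hy, hcard]
        simpa using Nat.mul_lt_mul_of_pos_right hmn hs
  refine Finset.eq_of_subset_of_card_le hsub ?_
  rw [hcard, (mem_lines.1 (h.line_mem_lines y (h.row_lt y w (hadj w (by simp [hne, hw]))))).2]

/-- The lines through `y` correspond to the rows of the local graph at `y`. -/
theorem sum_lines_mem (h : LocalGrid G s m n row col) (hs : 0 < s) (hmn : n < m) (y : V)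
    (F : Finset V → ℝ) :
    ∑ l ∈ (lines G s m).filter (fun l => y ∈ l), F l
      = ∑ j ∈ Finset.range n, F (line G row y j) := by
  symm
  refine Finset.sum_bij (fun j _ => line G row y j) ?_ ?_ ?_ (fun _ _ => rfl)
  · intro j hj
    rw [Finset.mem_filter]
    exact ⟨h.line_mem_lines y (by simpa using hj), by simp [mem_line]⟩
  · intro j hj j' hj' he
    have hpos : 0 < ((G.neighborFinset y).filter (fun w => row y w = j)).card := by
      rw [h.card_row y (by simpa using hj)]
      exact Nat.mul_pos (by omega) hs
    obtain ⟨w, hw⟩ := Finset.card_pos.1 hpos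
    simp only [Finset.mem_filter, SimpleGraph.mem_neighborFinset] at hw
    have : w ∈ line G row y j := (mem_line G row).2 (Or.inr hw)
    rw [he, mem_line] at this
    rcases this with rfl | h2
    · exact absurd hw.1 (G.irrefl)
    · rw [← hw.2, ← h2.2]
  · intro l hl
    rw [Finset.mem_filter] at hl
    obtain ⟨hl, hy⟩ := hl
    have hc := (mem_lines.1 hl)
    have : 1 < l.card := by
      have : 0 < m * s := Nat.mul_pos (by omega) hs
      omega
    obtain ⟨w, hw, hne⟩ := Finset.exists_mem_ne this y
    exact ⟨row y w, by simpa using h.row_lt y w (hc.1 hy hw hne.symm),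
      (h.eq_line_of_mem hs hmn hl hy hw hne).symm⟩

theorem row_eq_symm (h : LocalGrid G s m n row col) (hs : 0 < s) (hmn : n < m) {y z w : V}
    (hyz : G.Adj y z) (hyw : G.Adj y w) (hr : row y w = row y z) :
    row z w = row z y ∨ w = z := by
  have hl := h.line_mem_lines y (h.row_lt y z hyz)
  have hz : z ∈ line G row y (row y z) := (mem_line G row).2 (Or.inr ⟨hyz, rfl⟩)
  have hw : w ∈ line G row y (row y z) := (mem_line G row).2 (Or.inr ⟨hyw, hr⟩)
  have hy : y ∈ line G row y (row y z) := (mem_line G row).2 (Or.inl rfl)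
  rw [h.eq_line_of_mem hs hmn hl hz hy hyz.ne, mem_line] at hw
  rcases hw with hw | hw
  · exact Or.inr hw
  · exact Or.inl hw.2

/-- The columns at `y` and at `z` are a priori unrelated. A common neighbour off the line `yz` is in
the column of `z` at `y`, and in the column of `y` at `z`, simply because adjacency leaves no other
option. If `w` is on the line `yz`, adjacency to such an off-line vertex `v` settles its column; `v`
exists because there are at least two rows. -/
theorem col_eq_symm (h : LocalGrid G s m n row col) (hs : 0 < s) (hmn : n < m) (hn : 2 ≤ n)
    {y z w : V} (hyz : G.Adj y z) (hyw : G.Adj y w) (hzw : G.Adj z w)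
    (hc : col y w = col y z) : col z w = col z y := by
  have off : ∀ v, G.Adj y v → G.Adj z v → col y v = col y z → row y v ≠ row y z →
      col z v = col z y ∧ row z v ≠ row z y := by
    intro v hyv hzv hcv hrv
    have hr : row z v ≠ row z y := by
      intro e
      rcases h.row_eq_symm hs hmn hyz.symm hzv e with e | e
      · exact hrv e
      · exact hyv.ne e.symm
    exact ⟨((h.adj_iff z v y hzv hyz.symm).1 hyv.symm).2.resolve_left hr, hr⟩
  by_cases hr : row y w = row y z
  · obtain ⟨j, hj, hjr⟩ : ∃ j < n, j ≠ row y z := by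
      by_cases h0 : row y z = 0
      · exact ⟨1, by omega, by omega⟩
      · exact ⟨0, by omega, fun e => h0 e.symm⟩
    have hpos : 0 < ((G.neighborFinset y).filter
        (fun v => row y v = j ∧ col y v = col y z)).card := by
      rwa [h.card_cell y j (col y z) hj (h.col_lt y z hyz)]
    obtain ⟨v, hv⟩ := Finset.card_pos.1 hpos
    simp only [Finset.mem_filter, SimpleGraph.mem_neighborFinset] at hv
    obtain ⟨hyv, hvr, hvc⟩ := hv
    have hvz : v ≠ z := fun e => hjr (by rw [← hvr, e])
    have hvw : v ≠ w := fun e => hjr (by rw [← hvr, e, hr])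
    have hzv : G.Adj z v := (h.adj_iff y z v hyz hyv).2 ⟨hvz.symm, Or.inr hvc.symm⟩
    have hwv : G.Adj w v := (h.adj_iff y w v hyw hyv).2 ⟨hvw.symm, Or.inr (hc.trans hvc.symm)⟩
    obtain ⟨h1, h2⟩ := off v hyv hzv hvc (by rwa [hvr])
    have h3 : row z w = row z y := (h.row_eq_symm hs hmn hyz hyw hr).resolve_right hzw.ne'
    rw [← h1]
    exact ((h.adj_iff z w v hzw hzv).1 hwv).2.resolve_left (by rw [h3]; exact h2.symm)
  · exact (off w hyw hzw hc hr).1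

/-- A function `g` with `(A + n) g = 0` sums to zero on each line. -/
theorem sum_line_eq_zero (h : LocalGrid G s m n row col) (hs : 0 < s) (hmn : n < m)
    {g : V → ℝ} (hg : ∀ y, ∑ w ∈ G.neighborFinset y, g w = -(n : ℝ) * g y) (y : V) {j : ℕ}
    (hj : j < n) : g y + ∑ w ∈ (G.neighborFinset y).filter (fun w => row y w = j), g w = 0 := by
  have key : ∀ y, ∑ l ∈ (lines G s m).filter (fun l => y ∈ l), ∑ w ∈ l, g w = 0 := by
    intro y
    rw [h.sum_lines_mem hs hmn y (fun l => ∑ w ∈ l, g w)]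
    have : ∀ j, ∑ w ∈ line G row y j, g w
        = g y + ∑ w ∈ (G.neighborFinset y).filter (fun w => row y w = j), g w := fun j =>
      Finset.sum_insert (by simp)
    simp only [this]
    rw [Finset.sum_add_distrib, Finset.sum_fiberwise_of_maps_to, hg]
    · simp
    · intro w hw
      simpa using h.row_lt y w (by simpa using hw)
  -- This is `‖Nᵀg‖² = ⟨g, N Nᵀ g⟩`, and `key` says `N Nᵀ g = (A + n)g = 0`.
  have hsq : ∑ l ∈ lines G s m, (∑ w ∈ l, g w) ^ 2 = 0 := by
    calc ∑ l ∈ lines G s m, (∑ w ∈ l, g w) ^ 2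
        = ∑ l ∈ lines G s m, ∑ y, if y ∈ l then g y * ∑ w ∈ l, g w else 0 := by
          refine Finset.sum_congr rfl fun l _ => ?_
          rw [sq, Finset.sum_mul, ← Finset.sum_filter]
          simp
      _ = ∑ y, g y * ∑ l ∈ (lines G s m).filter (fun l => y ∈ l), ∑ w ∈ l, g w := by
          rw [Finset.sum_comm]
          refine Finset.sum_congr rfl fun y _ => ?_
          rw [← Finset.sum_filter, Finset.mul_sum]
      _ = 0 := by simp [key]
  have := (Finset.sum_eq_zero_iff_of_nonneg (fun l _ => sq_nonneg _)).1 hsq _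
    (h.line_mem_lines y hj)
  rw [line, Finset.sum_insert (by simp)] at this
  exact pow_eq_zero_iff (two_ne_zero) |>.1 this

end LocalGrid

/-! ### The standard sequence and the neighbours nearer to or farther from a base vertex -/

theorem bracket_zero (b : ℝ) : bracket b 0 = 0 := by simp [bracket]

theorem bracket_nonneg {b : ℝ} (hb : 0 ≤ b) (j : ℕ) : 0 ≤ bracket b j :=
  Finset.sum_nonneg fun _ _ => pow_nonneg hb _

theorem bracket_mono {b : ℝ} (hb : 0 ≤ b) : Monotone (bracket b) := fun _ _ hij =>
  Finset.sum_le_sum_of_subset_of_nonneg (Finset.range_subset_range.2 hij)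
    fun _ _ _ => pow_nonneg hb _

/-- The standard sequence of the eigenvalue `-[D]` of a distance-regular graph with classical
parameters `(D, b, α, β)`. -/
noncomputable def cosine (b α β : ℝ) : ℕ → ℝ
  | 0 => 1
  | j + 1 => -cosine b α β j * (1 + α * bracket b j) / (β - α * bracket b j)

section

variable {V : Type*} [Fintype V] (G : SimpleGraph V) [DecidableRel G.Adj]

/-- The neighbours of `y` that are nearer to `x` than `y`. -/
noncomputable def nearer (x y : V) : Finset V :=
  (G.neighborFinset y).filter (fun z => G.dist x z + 1 = G.dist x y)

/-- The neighbours of `y` that are farther from `x` than `y`. -/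
noncomputable def farther (x y : V) : Finset V :=
  (G.neighborFinset y).filter (fun z => G.dist x z = G.dist x y + 1)

variable {G} in
theorem mem_nearer {x y z : V} : z ∈ nearer G x y ↔ G.Adj y z ∧ G.dist x z + 1 = G.dist x y := by
  simp [nearer]

variable {G} in
theorem mem_farther {x y z : V} :
    z ∈ farther G x y ↔ G.Adj y z ∧ G.dist x z = G.dist x y + 1 := by
  simp [farther]

/-- A distance-regular graph with classical parameters `(D, b, α, β)` with coordinates on its
local graphs. -/
structure GridDRG [DecidableEq V] (D : ℕ) (b α β : ℝ) (s m n : ℕ) (row col : V → V → ℕ) : Prop where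
  grid : LocalGrid G s m n row col
  conn : G.Connected
  dist_le : ∀ x y, G.dist x y ≤ D
  card_nearer : ∀ x y, ((nearer G x y).card : ℝ)
    = bracket b (G.dist x y) * (1 + α * bracket b (G.dist x y - 1))
  card_farther : ∀ x y, ((farther G x y).card : ℝ)
    = (bracket b D - bracket b (G.dist x y)) * (β - α * bracket b (G.dist x y))
  two_le : 2 ≤ b
  s_eq : (s : ℝ) = α
  m_eq : (m : ℝ) * s = β
  n_eq : (n : ℝ) = bracket b D
  s_pos : 0 < s
  n_lt : n < m
  two_le_n : 2 ≤ n

end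

/-! ### Distance distribution along lines -/

namespace GridDRG

variable {V : Type*} [Fintype V] [DecidableEq V] {G : SimpleGraph V} [DecidableRel G.Adj]
  {D : ℕ} {b α β : ℝ} {s m n : ℕ} {row col : V → V → ℕ}

theorem dist_le_succ (h : GridDRG G D b α β s m n row col) (x : V) {y z : V} (hyz : G.Adj y z) :
    G.dist x z ≤ G.dist x y + 1 := by
  have := h.conn.dist_triangle (u := x) (v := y) (w := z)
  rwa [SimpleGraph.dist_eq_one_iff_adj.2 hyz] at this

theorem alpha_pos (h : GridDRG G D b α β s m n row col) : 0 < α := by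
  rw [← h.s_eq]
  exact_mod_cast h.s_pos

theorem alpha_bracket_nonneg (h : GridDRG G D b α β s m n row col) (j : ℕ) :
    0 ≤ α * bracket b j :=
  mul_nonneg h.alpha_pos.le (bracket_nonneg (by linarith [h.two_le]) j)

theorem sub_pos (h : GridDRG G D b α β s m n row col) {j : ℕ} (hj : j ≤ D) :
    0 < β - α * bracket b j := by
  have h1 : bracket b j ≤ n := by
    rw [h.n_eq]
    exact bracket_mono (by linarith [h.two_le]) hj
  have h2 : (n : ℝ) < m := by exact_mod_cast h.n_lt
  have := h.m_eq
  rw [h.s_eq] at this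
  have := h.alpha_pos
  nlinarith

theorem beta_nonneg (h : GridDRG G D b α β s m n row col) : 0 ≤ β := by
  rw [← h.m_eq]
  positivity

theorem cosine_ne_zero (h : GridDRG G D b α β s m n row col) {j : ℕ} (hj : j ≤ D) :
    cosine b α β j ≠ 0 := by
  induction j with
  | zero => simp [cosine]
  | succ j ih =>
    rw [cosine]
    have h1 := h.sub_pos (j := j) (by omega)
    have h2 := h.alpha_bracket_nonneg j
    exact div_ne_zero (mul_ne_zero (neg_ne_zero.2 (ih (by omega))) (by linarith)) h1.ne'

/-- This is the zero-sum condition on a line with `1 + α[j]` vertices at distance `j` from `x` and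
`β - α[j]` at distance `j + 1`. -/
theorem cosine_succ_mul (h : GridDRG G D b α β s m n row col) {j : ℕ} (hj : j ≤ D) :
    cosine b α β (j + 1) * (β - α * bracket b j)
      = -cosine b α β j * (1 + α * bracket b j) := by
  rw [cosine, div_mul_cancel₀ _ (h.sub_pos hj).ne']

theorem sum_dist (h : GridDRG G D b α β s m n row col) (u : ℕ → ℝ) (x y : V) {K : Finset V}
    (hK : ∀ w ∈ K, G.Adj y w) :
    ∑ w ∈ K, u (G.dist x w) = K.card * u (G.dist x y)
      + (K.filter (· ∈ nearer G x y)).card * (u (G.dist x y - 1) - u (G.dist x y))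
      + (K.filter (· ∈ farther G x y)).card * (u (G.dist x y + 1) - u (G.dist x y)) := by
  have : ∀ w ∈ K, u (G.dist x w) = u (G.dist x y)
      + (if w ∈ nearer G x y then u (G.dist x y - 1) - u (G.dist x y) else 0)
      + (if w ∈ farther G x y then u (G.dist x y + 1) - u (G.dist x y) else 0) := by
    intro w hw
    have h1 := h.dist_le_succ x (hK w hw)
    have h2 := h.dist_le_succ x (hK w hw).symm
    simp only [mem_nearer, mem_farther, hK w hw, true_and]
    rcases Nat.lt_trichotomy (G.dist x w) (G.dist x y) with h3 | h3 | h3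
    · rw [if_pos (by omega), if_neg (by omega), show G.dist x y - 1 = G.dist x w by omega]
      ring
    · rw [if_neg (by omega), if_neg (by omega), h3]
      ring
    · rw [if_neg (by omega), if_pos (by omega), show G.dist x y + 1 = G.dist x w by omega]
      ring
  rw [Finset.sum_congr rfl this, Finset.sum_add_distrib, Finset.sum_add_distrib,
    ← Finset.sum_filter, ← Finset.sum_filter]
  simp only [Finset.sum_const, nsmul_eq_mul]

theorem sum_cosine (h : GridDRG G D b α β s m n row col) (x y : V) :
    ∑ w ∈ G.neighborFinset y, cosine b α β (G.dist x w)
      = -(n : ℝ) * cosine b α β (G.dist x y) := by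
  rw [h.sum_dist (cosine b α β) x y (fun w hw => by simpa using hw)]
  have e1 : (G.neighborFinset y).filter (· ∈ nearer G x y) = nearer G x y := by
    ext w; simp [mem_nearer]
  have e2 : (G.neighborFinset y).filter (· ∈ farther G x y) = farther G x y := by
    ext w; simp [mem_farther]
  rw [e1, e2, h.card_nearer, h.card_farther, h.grid.degree_eq]
  have hd := h.dist_le x y
  have hm : ((n * m * s : ℕ) : ℝ) = bracket b D * β := by
    rw [← h.n_eq, ← h.m_eq]; push_cast; ring
  rw [hm, h.n_eq]
  have h2 := h.cosine_succ_mul hd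
  -- At distance `0` the truncated index `0 - 1` is harmless, as its coefficient contains `[0] = 0`.
  cases hi : G.dist x y with
  | zero =>
    rw [hi] at h2
    rw [bracket_zero] at *
    linear_combination bracket b D * h2
  | succ i =>
    rw [hi] at h2
    have h1 := h.cosine_succ_mul (j := i) (by omega)
    rw [Nat.add_sub_cancel]
    linear_combination (bracket b D - bracket b (i + 1)) * h2 + bracket b (i + 1) * h1

theorem card_row_nearer (h : GridDRG G D b α β s m n row col) (x y : V) {w : V}
    (hw : w ∈ nearer G x y) :
    (((nearer G x y).filter (fun v => row y v = row y w)).card : ℝ)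
      = 1 + α * bracket b (G.dist x y - 1) := by
  have hw' := mem_nearer.1 hw
  have hj := h.grid.row_lt y w hw'.1
  have h0 := h.grid.sum_line_eq_zero h.s_pos h.n_lt (h.sum_cosine x) y hj
  rw [h.sum_dist (cosine b α β) x y (fun w hw => by simp at hw; exact hw.1),
    h.grid.card_row y hj] at h0
  have e1 : ((G.neighborFinset y).filter (fun v => row y v = row y w)).filter (· ∈ nearer G x y)
      = (nearer G x y).filter (fun v => row y v = row y w) := by
    ext v; simp [mem_nearer]; tauto
  -- A farther vertex in the row of `w` would be adjacent to `w` although their distances from `x`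
  -- differ by two.
  have e2 : ((G.neighborFinset y).filter (fun v => row y v = row y w)).filter
      (· ∈ farther G x y) = ∅ := by
    rw [Finset.filter_eq_empty_iff]
    intro v hv hf
    rw [mem_farther] at hf
    simp only [Finset.mem_filter, SimpleGraph.mem_neighborFinset] at hv
    have hne : w ≠ v := fun e => by rw [e] at hw'; omega
    have := h.dist_le_succ x ((h.grid.adj_iff y w v hw'.1 hf.1).2 ⟨hne, Or.inl hv.2.symm⟩)
    omega
  rw [e1, e2] at h0
  push_cast at h0
  rw [h.m_eq, Finset.card_empty, Nat.cast_zero] at h0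
  have hd := h.dist_le x y
  obtain ⟨i, hi⟩ : ∃ i, G.dist x y = i + 1 := ⟨_, hw'.2.symm⟩
  rw [hi] at h0 hd ⊢
  rw [Nat.add_sub_cancel] at h0 ⊢
  have h1 := h.cosine_succ_mul (j := i) (by omega)
  have h2 := h.cosine_ne_zero (j := i) (by omega)
  have h3 := h.sub_pos (j := i) (by omega)
  have hβ := h.beta_nonneg
  generalize (((nearer G x y).filter (fun v => row y v = row y w)).card : ℝ) = N at *
  -- The zero sum reads `N u_i + (1 + β - N) u_{i+1} = 0` with `u` the standard sequence; the
  -- recursion eliminates `u_{i+1}`.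
  have : cosine b α β i * (1 + β) * (N - (1 + α * bracket b i)) = 0 := by
    linear_combination (β - α * bracket b i) * h0 - (1 + β - N) * h1
  have h4 := (mul_eq_zero.1 this).resolve_left (mul_ne_zero h2 (by linarith))
  linarith

theorem card_row_farther (h : GridDRG G D b α β s m n row col) (x y : V) {j : ℕ} (hj : j < n)
    (hd : G.dist x y < D) (hno : ∀ w ∈ nearer G x y, row y w ≠ j) :
    (((farther G x y).filter (fun v => row y v = j)).card : ℝ)
      = β - α * bracket b (G.dist x y) := by
  have h0 := h.grid.sum_line_eq_zero h.s_pos h.n_lt (h.sum_cosine x) y hj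
  rw [h.sum_dist (cosine b α β) x y (fun w hw => by simp at hw; exact hw.1),
    h.grid.card_row y hj] at h0
  have e1 : ((G.neighborFinset y).filter (fun v => row y v = j)).filter (· ∈ nearer G x y)
      = ∅ := by
    rw [Finset.filter_eq_empty_iff]
    intro v hv hf
    exact hno v hf (Finset.mem_filter.1 hv).2
  have e2 : ((G.neighborFinset y).filter (fun v => row y v = j)).filter (· ∈ farther G x y)
      = (farther G x y).filter (fun v => row y v = j) := by
    ext v; simp [mem_farther]; tauto
  rw [e1, e2] at h0
  push_cast at h0
  rw [h.m_eq, Finset.card_empty, Nat.cast_zero] at h0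
  have h1 := h.cosine_succ_mul (j := G.dist x y) hd.le
  have h2 := h.cosine_ne_zero (j := G.dist x y) hd.le
  have hβ := h.beta_nonneg
  generalize (((farther G x y).filter (fun v => row y v = j)).card : ℝ) = N at *
  have : cosine b α β (G.dist x y) * (1 + β) * (β - α * bracket b (G.dist x y) - N) = 0 := by
    linear_combination (β - α * bracket b (G.dist x y)) * h0 - N * h1
  have h4 := (mul_eq_zero.1 this).resolve_left (mul_ne_zero h2 (by linarith))
  linarith

/-! ### Rows and columns met by `C_i(x, y)` -/

/-- If all nonempty fibres of `f` on `C_i(x, y)` have size `1 + α [i - 1]`, then there are `[i]` of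
them. -/
theorem card_image_nearer (h : GridDRG G D b α β s m n row col) (x y : V) (f : V → ℕ)
    (hf : ∀ w ∈ nearer G x y, (((nearer G x y).filter (fun v => f v = f w)).card : ℝ)
      = 1 + α * bracket b (G.dist x y - 1)) :
    (((nearer G x y).image f).card : ℝ) = bracket b (G.dist x y) := by
  have h1 := h.card_nearer x y
  rw [Finset.card_eq_sum_card_image f, Nat.cast_sum, Finset.sum_congr rfl
    (g := fun _ => 1 + α * bracket b (G.dist x y - 1)), Finset.sum_const, nsmul_eq_mul] at h1
  · have := h.alpha_bracket_nonneg (G.dist x y - 1)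
    exact mul_right_cancel₀ (by linarith) h1
  · intro j hj
    obtain ⟨w, hw, rfl⟩ := Finset.mem_image.1 hj
    exact hf w hw

theorem card_image_row (h : GridDRG G D b α β s m n row col) (x y : V) :
    (((nearer G x y).image (row y)).card : ℝ) = bracket b (G.dist x y) :=
  h.card_image_nearer x y (row y) fun _ hw => h.card_row_nearer x y hw

/-- In the row of `w`, farther vertices must avoid the columns met by nearer ones. That leaves `(m -
[d])s = β - α[d]` places, where `d` is the distance from `x` to `z`, and this is exactly the number
of farther vertices in the row; so all these places, including `w`, are farther. -/
theorem mem_farther_of_forall_ne (h : GridDRG G D b α β s m n row col) {x z : V}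
    (hd : G.dist x z < D)
    (hP : (((nearer G x z).image (col z)).card : ℝ) = bracket b (G.dist x z)) {w : V}
    (hw : G.Adj z w) (hr : ∀ v ∈ nearer G x z, row z v ≠ row z w)
    (hc : ∀ v ∈ nearer G x z, col z v ≠ col z w) : w ∈ farther G x z := by
  have hB := h.card_row_farther x z (h.grid.row_lt z w hw) hd hr
  have hA : (nearer G x z).image (col z) ⊆ Finset.range m := by
    intro a ha
    obtain ⟨v, hv, rfl⟩ := Finset.mem_image.1 ha
    simpa using h.grid.col_lt z v (mem_nearer.1 hv).1
  have hK := h.grid.card_block z (J := {row z w})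
    (A := Finset.range m \ (nearer G x z).image (col z))
    (by simpa using h.grid.row_lt z w hw) (fun a ha => by
      rw [Finset.mem_sdiff, Finset.mem_range] at ha; exact ha.1)
  rw [Finset.card_singleton, one_mul, Finset.card_sdiff_of_subset hA, Finset.card_range] at hK
  have hsub : (farther G x z).filter (fun v => row z v = row z w) ⊆
      (G.neighborFinset z).filter (fun v => row z v ∈ ({row z w} : Finset ℕ) ∧
        col z v ∈ Finset.range m \ (nearer G x z).image (col z)) := by
    intro v hv
    simp only [Finset.mem_filter, mem_farther] at hv
    obtain ⟨⟨hzv, hdv⟩, hrv⟩ := hv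
    simp only [Finset.mem_filter, SimpleGraph.mem_neighborFinset, Finset.mem_singleton,
      Finset.mem_sdiff, Finset.mem_range, Finset.mem_image, not_exists]
    refine ⟨hzv, hrv, h.grid.col_lt z v hzv, ?_⟩
    rintro v' ⟨hv', e⟩
    rw [mem_nearer] at hv'
    have hne : v' ≠ v := fun e => by rw [e] at hv'; omega
    have := h.dist_le_succ x ((h.grid.adj_iff z v' v hv'.1 hzv).2 ⟨hne, Or.inr e⟩)
    omega
  have hcard : ((m - ((nearer G x z).image (col z)).card) * s : ℕ)
      = ((farther G x z).filter (fun v => row z v = row z w)).card := by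
    have hle : ((nearer G x z).image (col z)).card ≤ m := by
      simpa using Finset.card_le_card hA
    have : (((m - ((nearer G x z).image (col z)).card) * s : ℕ) : ℝ)
        = ((farther G x z).filter (fun v => row z v = row z w)).card := by
      rw [hB, Nat.cast_mul, Nat.cast_sub hle, hP, ← h.m_eq, ← h.s_eq]
      ring
    exact_mod_cast this
  have heq := Finset.eq_of_subset_of_card_le hsub (by rw [hK, hcard])
  have hmem : w ∈ (G.neighborFinset z).filter (fun v => row z v ∈ ({row z w} : Finset ℕ) ∧
        col z v ∈ Finset.range m \ (nearer G x z).image (col z)) := by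
    simp only [Finset.mem_filter, SimpleGraph.mem_neighborFinset, Finset.mem_singleton,
      Finset.mem_sdiff, Finset.mem_range, Finset.mem_image, not_exists]
    exact ⟨hw, trivial, h.grid.col_lt z w hw, fun v hv => hc v hv.1 hv.2⟩
  rw [← heq] at hmem
  exact (Finset.mem_filter.1 hmem).1

/-- If `y` is farther from `x` than its neighbour `z`, then no neighbour of `z` nearer to `x`
shares a row or a column with `y`. -/
theorem ne_of_mem_farther (h : GridDRG G D b α β s m n row col) {x y z : V}
    (hy : y ∈ farther G x z) {v : V} (hv : v ∈ nearer G x z) :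
    row z v ≠ row z y ∧ col z v ≠ col z y := by
  rw [mem_farther] at hy
  rw [mem_nearer] at hv
  have hne : v ≠ y := fun e => by rw [e] at hv; omega
  have : ¬ G.Adj v y := fun e => by have := h.dist_le_succ x e; omega
  rw [h.grid.adj_iff z v y hv.1 hy.1] at this
  tauto

/-- Seen from `z`, the other vertices counted are those in the column of `y` whose row meets the
nearer neighbours of `z`: a vertex of that column in a free row would be farther, and one in an
occupied row cannot be. There are `[d]` such rows, where `d` is the distance from `x` to `z`, each
contributing a cell of `α` vertices. -/
theorem card_col_nearer (h : GridDRG G D b α β s m n row col) {x y z : V}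
    (hz : z ∈ nearer G x y)
    (hP : (((nearer G x z).image (col z)).card : ℝ) = bracket b (G.dist x z)) :
    (((nearer G x y).filter (fun v => col y v = col y z)).card : ℝ)
      = 1 + α * bracket b (G.dist x z) := by
  have hz' := mem_nearer.1 hz
  have hd := h.dist_le x y
  have hyf : y ∈ farther G x z := mem_farther.2 ⟨hz'.1.symm, hz'.2.symm⟩
  have hyz := hz'.1
  have hset : (nearer G x y).filter (fun v => col y v = col y z)
      = insert z ((G.neighborFinset z).filter (fun w => row z w ∈ (nearer G x z).image (row z) ∧
          col z w ∈ ({col z y} : Finset ℕ))) := by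
    ext w
    simp only [Finset.mem_filter, Finset.mem_insert, SimpleGraph.mem_neighborFinset,
      Finset.mem_singleton]
    constructor
    · rintro ⟨hw, hcw⟩
      by_cases hwz : w = z
      · exact Or.inl hwz
      right
      have hw' := mem_nearer.1 hw
      have hzw : G.Adj z w := (h.grid.adj_iff y z w hyz hw'.1).2 ⟨fun e => hwz e.symm,
        Or.inr hcw.symm⟩
      have hc := h.grid.col_eq_symm h.s_pos h.n_lt h.two_le_n hyz hw'.1 hzw hcw
      refine ⟨hzw, ?_, hc⟩
      by_contra hr
      have hr' : ∀ v ∈ nearer G x z, row z v ≠ row z w := fun v hv e =>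
        hr (Finset.mem_image.2 ⟨v, hv, e⟩)
      have := mem_farther.1 (h.mem_farther_of_forall_ne (by omega) hP hzw hr'
        (fun v hv => by rw [hc]; exact (h.ne_of_mem_farther hyf hv).2))
      omega
    · rintro (rfl | ⟨hzw, hr, hc⟩)
      · exact ⟨hz, rfl⟩
      · obtain ⟨v, hv, e⟩ := Finset.mem_image.1 hr
        have hwy : w ≠ y := fun e' => (h.ne_of_mem_farther hyf hv).1 (by rw [e, e'])
        have hwy' : G.Adj w y := (h.grid.adj_iff z w y hzw hyz.symm).2 ⟨hwy, Or.inr hc⟩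
        have hwf : w ∉ farther G x z := fun hwf => (h.ne_of_mem_farther hwf hv).1 e
        have h1 : ¬ (G.dist x w = G.dist x z + 1) := fun e' => hwf (mem_farther.2 ⟨hzw, e'⟩)
        have h2 := h.dist_le_succ x hwy'
        have h3 := h.dist_le_succ x hzw
        exact ⟨mem_nearer.2 ⟨hwy'.symm, by omega⟩,
          h.grid.col_eq_symm h.s_pos h.n_lt h.two_le_n hyz.symm hzw hwy'.symm hc⟩
  rw [hset, Finset.card_insert_of_notMem (by simp), h.grid.card_block z]
  · push_cast
    rw [h.card_image_row, h.s_eq]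
    simp only [Finset.card_singleton, Nat.cast_one]
    ring
  · intro j hj
    obtain ⟨v, hv, rfl⟩ := Finset.mem_image.1 hj
    exact h.grid.row_lt z v (mem_nearer.1 hv).1
  · intro a ha
    rw [Finset.mem_singleton.1 ha]
    exact h.grid.col_lt z y hyz.symm

theorem card_image_col (h : GridDRG G D b α β s m n row col) (x y : V) :
    (((nearer G x y).image (col y)).card : ℝ) = bracket b (G.dist x y) := by
  induction hi : G.dist x y generalizing y with
  | zero =>
    have : nearer G x y = ∅ := by
      ext v
      simp [mem_nearer, hi]
    simp [this, bracket_zero]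
  | succ i ih =>
    rw [← hi]
    refine h.card_image_nearer x y (col y) fun z hz => ?_
    have hz' := (mem_nearer.1 hz).2
    have hdz : G.dist x z = i := by omega
    rw [h.card_col_nearer hz (by rw [hdz]; exact ih z hdz), hdz, hi, Nat.add_sub_cancel]

/-- Otherwise `w` would share the cell of `y` in the local graph at `z`. That cell lies in a free
row and a free column, so `w` would be farther from `x` than `z`, yet both are at the same distance.
-/
theorem eq_of_row_eq_of_col_eq (h : GridDRG G D b α β s m n row col) {x y z w : V}
    (hz : z ∈ nearer G x y) (hw : w ∈ nearer G x y) (hr : row y w = row y z)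
    (hc : col y w = col y z) : w = z := by
  by_contra hne
  have hz' := mem_nearer.1 hz
  have hw' := mem_nearer.1 hw
  have hd := h.dist_le x y
  have hyf : y ∈ farther G x z := mem_farther.2 ⟨hz'.1.symm, hz'.2.symm⟩
  have hzw : G.Adj z w := (h.grid.adj_iff y z w hz'.1 hw'.1).2 ⟨Ne.symm hne, Or.inr hc.symm⟩
  have hc' := h.grid.col_eq_symm h.s_pos h.n_lt h.two_le_n hz'.1 hw'.1 hzw hc
  have hr' := (h.grid.row_eq_symm h.s_pos h.n_lt hz'.1 hw'.1 hr).resolve_right hne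
  have := mem_farther.1 (h.mem_farther_of_forall_ne (by omega) (h.card_image_col x z) hzw
    (fun v hv => by rw [hr']; exact (h.ne_of_mem_farther hyf hv).1)
    (fun v hv => by rw [hc']; exact (h.ne_of_mem_farther hyf hv).2))
  omega

theorem isInducedSubgraphOfGrid (h : GridDRG G D b α β s m n row col) (x y : V) :
    IsInducedSubgraphOfGrid (G.induce (CSet G (G.dist x y) x y)) (bracket b (G.dist x y))
      (bracket b (G.dist x y)) := by
  have hmem : ∀ z : CSet G (G.dist x y) x y, (z : V) ∈ nearer G x y := fun z =>
    mem_nearer.2 ⟨z.2.2, z.2.1⟩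
  refine ⟨((nearer G x y).image (col y)).card, ((nearer G x y).image (row y)).card,
    h.card_image_col x y, h.card_image_row x y, ⟨⟨⟨fun z =>
      (((nearer G x y).image (col y)).equivFin ⟨col y z, Finset.mem_image_of_mem _ (hmem z)⟩,
        ((nearer G x y).image (row y)).equivFin ⟨row y z, Finset.mem_image_of_mem _ (hmem z)⟩),
      ?_⟩, ?_⟩⟩⟩
  · intro z w hzw
    simp only [Prod.mk.injEq, EmbeddingLike.apply_eq_iff_eq, Subtype.mk.injEq] at hzw
    exact Subtype.ext (h.eq_of_row_eq_of_col_eq (hmem w) (hmem z) hzw.2 hzw.1)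
  · intro z w
    have h1 := h.grid.adj_iff y z w z.2.2 w.2.2
    have h2 := fun hr hc => h.eq_of_row_eq_of_col_eq (hmem w) (hmem z) hr hc
    change (ClassicalDRG.grid _ _).Adj (_, _) (_, _) ↔ G.Adj z w
    simp only [ClassicalDRG.grid, SimpleGraph.boxProd_adj, SimpleGraph.top_adj,
      Ne, EmbeddingLike.apply_eq_iff_eq, Subtype.mk.injEq]
    rw [h1]
    have h3 : (z : V) = w → row y z = row y w ∧ col y z = col y w := fun e => by simp [e]
    tauto

end GridDRG

end ClassicalDRG

/-! ### Assembling the data from the hypotheses -/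

theorem theorem27 {V : Type*} [Fintype V] [DecidableEq V] (G : SimpleGraph V)
    [DecidableRel G.Adj] (D : ℕ) (b α β : ℝ)
    (hgeom : ClassicalDRG.IsGeometric G)
    (hcp : ClassicalDRG.HasClassicalParameters G D b α β)
    (hb : 2 ≤ b) (hα : 1 ≤ α) (hαb : α ≤ b - 1) (hD : 3 ≤ D)
    (hlocal : ∀ x : V, ClassicalDRG.IsCliqueExtensionOfGrid (ClassicalDRG.localGraph G x)
      α (β / α) (ClassicalDRG.bracket b D))
    (hβ : α * ClassicalDRG.bracket b D < β) :
    ∀ i : ℕ, 2 ≤ i → i ≤ D → ∀ x y : V, G.dist x y = i →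
      ClassicalDRG.IsInducedSubgraphOfGrid (G.induce (ClassicalDRG.CSet G i x y))
        (ClassicalDRG.bracket b i) (ClassicalDRG.bracket b i) := by
  rintro i - - x y rfl
  obtain ⟨hdiam, bi, ci, hint, hbi, hci⟩ := hcp
  obtain ⟨s, m, n, hs, hsα, hmβ, hnD, -⟩ := hlocal x
  have hα0 : α ≠ 0 := by linarith
  have hiso : ∀ z, Nonempty (ClassicalDRG.localGraph G z ≃g
      ClassicalDRG.cliqueExtension (ClassicalDRG.grid m n) s) := by
    intro z
    obtain ⟨s', m', n', -, hs', hm', hn', e⟩ := hlocal z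
    obtain rfl : s' = s := by exact_mod_cast hs'.trans hsα.symm
    obtain rfl : m' = m := by exact_mod_cast hm'.trans hmβ.symm
    obtain rfl : n' = n := by exact_mod_cast hn'.trans hnD.symm
    exact e
  obtain ⟨row, col, hgrid⟩ := ClassicalDRG.exists_localGrid G s m n hiso
  have hdist : ∀ x y, G.dist x y ≤ D := by
    intro x y
    rw [← hdiam]
    have := hint.connected.nonempty
    exact SimpleGraph.dist_le_diam (SimpleGraph.connected_iff_ediam_ne_top.1 hint.connected)
  have h : ClassicalDRG.GridDRG G D b α β s m n row col :=
    { grid := hgrid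
      conn := hint.connected
      dist_le := hdist
      card_nearer := by
        intro x y
        have hset : ClassicalDRG.CSet G (G.dist x y) x y = ClassicalDRG.nearer G x y := by
          ext z
          rw [Finset.mem_coe, ClassicalDRG.mem_nearer]
          exact and_comm
        have hc := hint.card_CSet _ x y rfl
        rw [hset, Set.ncard_coe_finset] at hc
        -- The formula for `c_i` is given for `i ≥ 1` only; at `i = 0` both sides vanish. Likewise
        -- for `b_i` at `i = D` below.
        rcases Nat.eq_zero_or_pos (G.dist x y) with h0 | h0
        · have : ClassicalDRG.nearer G x y = ∅ := by
            ext v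
            simp [ClassicalDRG.mem_nearer, h0]
          simp [this, h0, ClassicalDRG.bracket_zero]
        · rw [hc, hci _ h0 (hdist x y)]
      card_farther := by
        intro x y
        have hset : ClassicalDRG.BSet G (G.dist x y) x y = ClassicalDRG.farther G x y := by
          ext z
          rw [Finset.mem_coe, ClassicalDRG.mem_farther]
          exact and_comm
        have hc := hint.card_BSet _ x y rfl
        rw [hset, Set.ncard_coe_finset] at hc
        rcases (hdist x y).eq_or_lt with h0 | h0
        · have : ClassicalDRG.farther G x y = ∅ := by
            ext v
            have := hdist x v
            simp only [ClassicalDRG.mem_farther, Finset.notMem_empty, iff_false]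
            omega
          simp [this, h0]
        · rw [hc, hbi _ h0]
      two_le := hb
      s_eq := hsα
      m_eq := by rw [hmβ, hsα, div_mul_cancel₀ _ hα0]
      n_eq := hnD
      s_pos := hs
      n_lt := by
        have : (n : ℝ) < m := by
          rw [hnD, hmβ, lt_div_iff₀ (by linarith), mul_comm]
          exact hβ
        exact_mod_cast this
      two_le_n := by
        have : ClassicalDRG.bracket b 2 ≤ n := by
          rw [hnD]
          exact ClassicalDRG.bracket_mono (by linarith) (by omega)
        have h2 : (2 : ℝ) ≤ n := by
          simp only [ClassicalDRG.bracket, Finset.sum_range_succ, Finset.sum_range_zero, pow_zero,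
            pow_one] at this
          linarith
        exact_mod_cast h2 }
  exact h.isInducedSubgraphOfGrid x y
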